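/- Let $m\ge 1$, let ${\bf d}=(d_1<\dots<d_m)$ minimally generate a numerical semigroup $S$, and let $F$ be its Frobenius number, $\Sigma=d_1+\dots+d_m$ and $\Delta_{\mathcal H}=\{h\in\mathbb N : h\notin S,\ F-h\notin S\}$. Multisets are joined by adding multiplicities ($\bigvee$) and intersected by taking minima of multiplicities ($\bigwedge$). For $1\le i\le m-1$ let $\mathfrak L_i$ be the multiset of all sums $d_{j_1}+\dots+d_{j_i}+h$ with $j_1<\dots<j_i$ and $h\in\Delta_{\mathcal H}$, and let $\mathfrak L_o$ (resp. $\mathfrak L_e$) be the join of the $\mathfrak L_i$ over the odd (resp. even) $i$ with $1\le i\le m-1$. Put $\ell({\bf d})=\#\big(\mathfrak L_o\bigwedge\mathfrak L_e\big)$. Let ${\sf k}$ be a field of characteristic $0$. For $i\ge 1$ let $\mathfrak B_i$ be the multiset of the syzygy degrees $C_{1,i},\dots,C_{\beta_i,i}$ of the $i$-th kind, that is, the degrees of the basis elements of the $i$-th free module in a minimal graded free resolution of the semigroup ring ${\sf k}[z^{d_1},\dots,z^{d_m}]$ over ${\sf k}[X_1,\dots,X_m]$, $\deg X_j=d_j$,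 and let $\overline{\mathfrak B}_i$ be the multiset of the conjugate degrees $F+\Sigma-C_{j,i}$, $1\le j\le\beta_i$. Let $\mathfrak B_o,\overline{\mathfrak B}_o$ (resp. $\mathfrak B_e,\overline{\mathfrak B}_e$) be the joins of the $\mathfrak B_i$, $\overline{\mathfrak B}_i$ over the odd (resp. even) $i$ with $1\le i\le m-2$. For odd $m$ put $$\rho({\bf d})=\#\Big(\big[\mathfrak B_o\textstyle\bigvee\overline{\mathfrak B}_e\big]\bigwedge\big[\mathfrak B_e\bigvee\overline{\mathfrak B}_o\big]\Big).$$ Let $n\ge 1$ and $a\ge 1$ be integers with $\gcd(2n+1,a)=1$, and let $${\bf c}=(2n+1,\ 2n+1+2a,\ 2n+1+4a,\ \dots,\ 2n+1+4na),$$ a tuple of $m=2n+1$ generators (it generates an almost symmetric numerical semigroup of maximal embedding dimension). Then $$\rho({\bf c})=\ell({\bf c})=0.$$ -/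

import Mathlib

namespace NumSemigroup

/-! Throughout, `d : Fin m → ℕ` lists the generators `d_1, …, d_m` of the semigroup. -/

section Combinatorics

variable {m : ℕ} (d : Fin m → ℕ)

/-- The semigroup `S(d)` of all combinations of the `d_i` with coefficients in `{0, 1, 2, …}`. -/
def semigroup : AddSubmonoid ℕ := AddSubmonoid.closure (Set.range d)

/-- The conductor: the least `s ∈ S(d)` such that `s + t ∈ S(d)` for all `t ≥ 0`. -/
noncomputable def conductor : ℕ :=
  sInf {s : ℕ | s ∈ semigroup d ∧ ∀ t : ℕ, s + t ∈ semigroup d}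

/-- The Frobenius number, an integer (it is `-1` for the semigroup of all nonnegative integers). -/
noncomputable def frobenius : ℤ := (conductor d : ℤ) - 1

/-- The sum of the generators. -/
def genSum : ℕ := ∑ i, d i

open Classical in
/-- The set `Δ_H` of those gaps `h` of `S(d)` for which `F - h` is not in `S(d)` either
(all gaps are below the conductor). -/
noncomputable def gapsH : Finset ℕ :=
  (Finset.range (conductor d)).filter fun h =>
    h ∉ semigroup d ∧ ∀ s ∈ semigroup d, frobenius d - (h : ℤ) ≠ (s : ℤ)

/-- The multiset of the sums of `i` generators with distinct indices, one for each
`i`-element set of indices. -/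
def subsetSums (i : ℕ) : Multiset ℕ :=
  (Finset.powersetCard i (Finset.univ : Finset (Fin m))).val.map fun T => ∑ j ∈ T, d j

/-- The multiset of the `d_{j_1} + ⋯ + d_{j_i} + h` with `j_1 < ⋯ < j_i` and `h ∈ Δ_H`. -/
noncomputable def shiftedSums (i : ℕ) : Multiset ℕ :=
  (subsetSums d i).bind fun x => (gapsH d).val.map fun h => x + h

/-- The join (sum of multiplicities) of the `shiftedSums d i` over the odd `i`,
`1 ≤ i ≤ m - 1`. -/
noncomputable def shiftedSumsOdd : Multiset ℕ :=
  ∑ i ∈ (Finset.Icc 1 (m - 1)).filter (fun i => Odd i), shiftedSums d i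

/-- The join of the `shiftedSums d i` over the even `i`, `1 ≤ i ≤ m - 1`. -/
noncomputable def shiftedSumsEven : Multiset ℕ :=
  ∑ i ∈ (Finset.Icc 1 (m - 1)).filter (fun i => Even i), shiftedSums d i

/-- The cardinality `ℓ(d)` of the intersection (minimum of multiplicities) of the two multisets
`shiftedSumsEven d` and `shiftedSumsOdd d`. -/
noncomputable def ell : ℕ := Multiset.card (shiftedSumsEven d ∩ shiftedSumsOdd d)

end Combinatorics

section Resolution

variable (k : Type*) [Field k] {m : ℕ} (d : Fin m → ℕ)

/-- The ideal of relations of the semigroup ring `k[z^{d_1}, …, z^{d_m}]`: the kernel of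
`k[X_1, …, X_m] → k[z]`, `X_i ↦ z^{d_i}`. -/
noncomputable def relationIdeal : Ideal (MvPolynomial (Fin m) k) :=
  RingHom.ker (MvPolynomial.aeval fun i => (Polynomial.X : Polynomial k) ^ d i)

/-- A minimal graded free resolution
`⋯ → F_2 → F_1 → F_0 = R → k[z^{d_1}, …, z^{d_m}] → 0`
of the semigroup ring over `R = k[X_1, …, X_m]`, graded by `deg X_i = d_i`, with bases. The module
`F_i` is free on `rank i` generators (so `rank i` is the Betti number `β_i`), its `j`-th basis
element has degree `degree i j` (so these are the syzygy degrees `C_{j,i}` of the `i`-th kind),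
and `diff i` is the matrix of `F_{i+1} → F_i`. -/
structure MinimalResolution where
  rank : ℕ → ℕ
  degree : (i : ℕ) → Fin (rank i) → ℕ
  diff : (i : ℕ) → Matrix (Fin (rank i)) (Fin (rank (i + 1))) (MvPolynomial (Fin m) k)
  /-- `F_0 = R`. -/
  rank_zero : rank 0 = 1
  degree_zero : ∀ j, degree 0 j = 0
  /-- The differentials preserve degrees. -/
  homogeneous : ∀ i r j, ∀ e : Fin m →₀ ℕ, (diff i r j).coeff e ≠ 0 →
    Finsupp.weight d e + degree i r = degree (i + 1) j
  /-- Minimality: all matrix entries lie in the ideal `(X_1, …, X_m)`. -/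
  minimal : ∀ i r j, MvPolynomial.constantCoeff (diff i r j) = 0
  /-- The image of `F_1` in `F_0 = R` is the ideal of relations. -/
  exact_zero : ∀ v : Fin (rank 0) → MvPolynomial (Fin m) k,
    (∀ j, v j ∈ relationIdeal k d) ↔ ∃ w, (diff 0).mulVec w = v
  /-- Exactness at `F_{i+1}`. -/
  exact_succ : ∀ (i : ℕ) (v : Fin (rank (i + 1)) → MvPolynomial (Fin m) k),
    (diff i).mulVec v = 0 ↔ ∃ w, (diff (i + 1)).mulVec w = v

namespace MinimalResolution

variable {k d} (R : MinimalResolution k d)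

/-- The multiset of the syzygy degrees `C_{j,i}`, `1 ≤ j ≤ β_i`. -/
def syz (i : ℕ) : Multiset ℤ :=
  (Finset.univ : Finset (Fin (R.rank i))).val.map fun j => (R.degree i j : ℤ)

/-- The multiset of the conjugate degrees `F + Σ_m - C_{j,i}`, `1 ≤ j ≤ β_i`. -/
noncomputable def conjSyz (i : ℕ) : Multiset ℤ :=
  (R.syz i).map fun c => frobenius d + (genSum d : ℤ) - c

/-- The join of the multisets `R.syz i` over the odd `i`, `1 ≤ i ≤ m - 2`. -/
def syzOdd : Multiset ℤ :=
  ∑ i ∈ (Finset.Icc 1 (m - 2)).filter (fun i => Odd i), R.syz i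

/-- The join of the multisets `R.syz i` over the even `i`, `1 ≤ i ≤ m - 2`. -/
def syzEven : Multiset ℤ :=
  ∑ i ∈ (Finset.Icc 1 (m - 2)).filter (fun i => Even i), R.syz i

/-- The join of the multisets `R.conjSyz i` over the odd `i`, `1 ≤ i ≤ m - 2`. -/
noncomputable def conjSyzOdd : Multiset ℤ :=
  ∑ i ∈ (Finset.Icc 1 (m - 2)).filter (fun i => Odd i), R.conjSyz i

/-- The join of the multisets `R.conjSyz i` over the even `i`, `1 ≤ i ≤ m - 2`. -/
noncomputable def conjSyzEven : Multiset ℤ :=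
  ∑ i ∈ (Finset.Icc 1 (m - 2)).filter (fun i => Even i), R.conjSyz i

/-- The multiset of all syzygy degrees and conjugate degrees which enter the left-hand side. -/
noncomputable def leftDegrees : Multiset ℤ :=
  R.syzOdd + (if Even m then R.conjSyzOdd else R.conjSyzEven)

/-- The multiset of all syzygy degrees and conjugate degrees which enter the right-hand side. -/
noncomputable def rightDegrees : Multiset ℤ :=
  R.syzEven + (if Even m then R.conjSyzEven else R.conjSyzOdd)

/-- The cardinality `ρ(d)` of the intersection of the multisets `R.leftDegrees` and
`R.rightDegrees`. -/
noncomputable def rho : ℕ := Multiset.card (R.leftDegrees ∩ R.rightDegrees)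

end MinimalResolution

end Resolution

/-- The tuple `2n+1, 2n+1+2a, …, 2n+1+4na` of `2n+1` terms in arithmetic progression. -/
def arithTuple (n a : ℕ) : Fin (2 * n + 1) → ℕ := fun j => 2 * n + 1 + 2 * (j : ℕ) * a

end NumSemigroup

/-! Everything is a parity argument. All generators are odd. Every `h ∈ Δ_H` is even: in each
residue class the largest gap is `2ja`, and `F - h` lies in the semigroup for every smaller gap `h`
of that class. Hence the elements of `𝔏_i` have the parity of `i`, and `ℓ = 0` (`ell_arithTuple`).

For `ρ` it suffices that the syzygy degrees of the `i`-th kind, `i ≥ 1`, have the parity of `i + 1`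
(`degree_succ_cast`): `F = 4na` is even and `Σ` is odd, so the conjugate degrees have the parity of
`i`, all left degrees are even and all right degrees are odd.

The syzygy degrees are the degrees of the Koszul homology of the semigroup ring `A`. The variable `X
0` is regular on `A`, and the sum of two generators is `c_0` plus an element of the semigroup, so `A
/ X 0` is spanned by `1` and the remaining generators. Its even part is `k`, and the remaining
variables are independent in the odd part; hence the homology with even coefficients is just `k` at
the root (`evenAcyclic_relationIdeal`). Dimension shifting along the resolution carries this to each
syzygy module (`exists_d_mulVec_eq`), and a Nakayama argument then excludes minimal generators of
the wrong parity. -/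

namespace Koszul

/-! ### The Koszul complex as an iterated mapping cone. -/

/-- The index set of the basis of the exterior algebra on the list `l`. -/
inductive Index {σ : Type*} : List σ → Type _
  | nil : Index []
  | inl {a : σ} {l : List σ} : Index l → Index (a :: l)
  | inr {a : σ} {l : List σ} : Index l → Index (a :: l)

variable {σ : Type*} {A : Type*} [CommRing A] {N : Type*} [AddCommGroup N] [Module A N]
  {N' : Type*} [AddCommGroup N'] [Module A N']

/-- The index of the element `1` of the exterior algebra. -/
def root : (l : List σ) → Index l
  | [] => .nil
  | _ :: l => .inl (root l)

/-- The chain with value `v` at the root, and `0` elsewhere. -/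
def rootChain (v : N) : {l : List σ} → Index l → N
  | _, .nil => v
  | _, .inl t => rootChain v t
  | _, .inr _ => 0

/-- The differential of the Koszul complex of the elements `x a`, `a ∈ l`, with coefficients in
`N`, built as an iterated mapping cone. -/
def d (x : σ → A) : {l : List σ} → (Index l → N) → Index l → N
  | _, _, .nil => 0
  | a :: _, f, .inl t => d x (fun t => f (.inl t)) t + x a • f (.inr t)
  | _, f, .inr t => -d x (fun t => f (.inr t)) t

variable (x : σ → A)

@[simp] lemma d_nil (f : Index ([] : List σ) → N) : d x f .nil = 0 := rfl

@[simp] lemma d_inl {a : σ} {l : List σ} (f : Index (a :: l) → N) (t : Index l) :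
    d x f (.inl t) = d x (fun t => f (.inl t)) t + x a • f (.inr t) := rfl

@[simp] lemma d_inr {a : σ} {l : List σ} (f : Index (a :: l) → N) (t : Index l) :
    d x f (.inr t) = -d x (fun t => f (.inr t)) t := rfl

@[simp] lemma rootChain_root (l : List σ) (v : N) : rootChain v (root l) = v := by
  induction l with
  | nil => rfl
  | cons a l ih => exact ih

/-- If `ψ (x a • v) = x a • φ v` for all `a`, then the Koszul differential intertwines `φ`
and `ψ`. -/
lemma d_intertwine (φ ψ : N →+ N') {l : List σ} (h : ∀ a ∈ l, ∀ v, ψ (x a • v) = x a • φ v)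
    (f : Index l → N) (t : Index l) : d x (fun t => φ (f t)) t = ψ (d x f t) := by
  induction t with
  | nil => simp
  | inl t ih =>
    simp [ih fun a ha => h a (List.mem_cons_of_mem _ ha), h _ List.mem_cons_self]
  | inr t ih => simp [ih fun a ha => h a (List.mem_cons_of_mem _ ha)]

lemma d_map (φ : N →ₗ[A] N') {l : List σ} (f : Index l → N) (t : Index l) :
    d x (fun t => φ (f t)) t = φ (d x f t) :=
  d_intertwine x φ.toAddMonoidHom φ.toAddMonoidHom (fun _ _ _ => map_smul φ _ _) f t

lemma d_add {l : List σ} (f g : Index l → N) (t : Index l) :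
    d x (fun t => f t + g t) t = d x f t + d x g t := by
  induction t with
  | nil => simp
  | inl t ih =>
    simp only [d_inl, ih, smul_add]
    abel
  | inr t ih =>
    simp only [d_inr, ih]
    abel

lemma d_neg {l : List σ} (f : Index l → N) (t : Index l) : d x (fun t => -f t) t = -d x f t :=
  d_map x (-LinearMap.id) f t

lemma d_smul (c : A) {l : List σ} (f : Index l → N) (t : Index l) :
    d x (fun t => c • f t) t = c • d x f t :=
  d_map x (c • LinearMap.id) f t

lemma d_sub {l : List σ} (f g : Index l → N) (t : Index l) :
    d x (fun t => f t - g t) t = d x f t - d x g t := by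
  simp only [sub_eq_add_neg, d_add, d_neg]

lemma d_zero {l : List σ} (t : Index l) : d x (fun _ => (0 : N)) t = 0 :=
  d_map x (0 : N →ₗ[A] N) (fun _ => 0) t

lemma d_d {l : List σ} (f : Index l → N) (t : Index l) : d x (d x f) t = 0 := by
  induction t with
  | nil => rfl
  | inl t ih => simp [d_add, d_smul, ih]
  | inr t ih => simp [d_neg, ih]

@[simp] lemma d_rootChain {l : List σ} (v : N) (t : Index l) : d x (rootChain v) t = 0 := by
  induction t with
  | nil => rfl
  | inl t ih => simpa [rootChain] using ih
  | inr t ih => simpa [rootChain] using d_zero x t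

lemma d_mem (M : Submodule A N) {l : List σ} (f : Index l → N) (h : ∀ t, f t ∈ M)
    (t : Index l) : d x f t ∈ M := by
  induction t with
  | nil => exact M.zero_mem
  | inl t ih => exact M.add_mem (ih _ fun t => h _) (M.smul_mem _ (h _))
  | inr t ih => exact M.neg_mem (ih _ fun t => h _)

/-! ### Exactness over the polynomial ring, and the parity grading. -/

section Polynomial

open MvPolynomial

variable {k : Type*} [Field k] {β : Type*}

local notation "V" => fun i => (X i : MvPolynomial σ k)

lemma X_mul_eq_zero_coeff {a : σ} {f : MvPolynomial σ k} {e : σ →₀ ℕ} (h : e a = 0) :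
    coeff e (X a * f) = 0 := by
  classical
  rw [coeff_X_mul', if_neg (by simpa using h)]

/-- The root component of a boundary is a combination of the variables in `l`, so none of its
monomials avoids all of them. -/
lemma coeff_d_root {l : List σ} (f : Index l → β → MvPolynomial σ k) (i : β) {e : σ →₀ ℕ}
    (h : ∀ a ∈ l, e a = 0) : coeff e (d V f (root l) i) = 0 := by
  induction l with
  | nil => simp [root]
  | cons a l ih =>
    simp only [root, d_inl, Pi.add_apply, coeff_add, Pi.smul_apply, smul_eq_mul]
    rw [ih _ fun b hb => h b (List.mem_cons_of_mem _ hb),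
      X_mul_eq_zero_coeff (h a List.mem_cons_self), add_zero]

lemma exists_eq_X_mul_add (a : σ) (f : MvPolynomial σ k) :
    ∃ g r : MvPolynomial σ k, f = X a * g + r ∧ ∀ e : σ →₀ ℕ, e a ≠ 0 → coeff e r = 0 := by
  refine ⟨f.divMonomial (Finsupp.single a 1), f.modMonomial (Finsupp.single a 1), ?_, ?_⟩
  · exact (divMonomial_add_modMonomial_single f a).symm
  · intro e he
    exact coeff_modMonomial_of_le f (by simpa [Nat.one_le_iff_ne_zero] using he)

/-- The Koszul complex of distinct variables, with coefficients in a free module, is exact except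
at the root. -/
theorem exists_d_eq {l : List σ} (hl : l.Nodup) (z : Index l → β → MvPolynomial σ k)
    (hz : ∀ t, d V z t = 0)
    (hroot : ∀ i, ∀ e : σ →₀ ℕ, (∀ a ∈ l, e a = 0) → coeff e (z (root l) i) = 0) :
    ∃ w, ∀ t, d V w t = z t := by
  induction l with
  | nil =>
    refine ⟨0, fun t => ?_⟩
    cases t
    ext i e
    simpa [root] using (hroot i e (by simp)).symm
  | cons a l ih =>
    obtain ⟨hal, hl⟩ := List.nodup_cons.1 hl
    have hb : ∀ t, d V (fun t => z (.inr t)) t = 0 := fun t => neg_eq_zero.1 (hz (.inr t))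
    have ha : ∀ t, d V (fun t => z (.inl t)) t + (X a : MvPolynomial σ k) • z (.inr t) = 0 :=
      fun t => hz (.inl t)
    -- The root condition for the `inr` half holds because `X a` times its root value is minus the
    -- root value of a boundary; `coeff_d_root` applies since `a ∉ l`.
    obtain ⟨c, hc⟩ := ih hl _ hb fun i e he => by
      classical
      have h := congrArg (coeff (e + Finsupp.single a 1)) (congrFun (ha (root l)) i)
      simp only [Pi.add_apply, coeff_add, Pi.smul_apply, smul_eq_mul, Pi.zero_apply,
        coeff_zero] at h
      rw [coeff_d_root, zero_add, add_comm, coeff_X_mul] at h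
      · exact h
      · intro b hb
        have : a ≠ b := fun h => hal (h ▸ hb)
        simp [he b hb, this]
    -- Adding `X a • c` makes the `inl` half a cycle for `l`, but its root value may contain
    -- monomials in `X a` alone. The part `X a * g` divisible by `X a` is removed by a root chain,
    -- which is itself a cycle.
    choose g r hgr hr using fun i => exists_eq_X_mul_add a
      ((z (.inl (root l)) + (X a : MvPolynomial σ k) • c (root l)) i)
    obtain ⟨w, hw⟩ := ih hl
      (fun t => z (.inl t) + (X a : MvPolynomial σ k) • c t -
        (X a : MvPolynomial σ k) • rootChain g t)
      (fun t => by
        rw [d_sub, d_add, d_smul, d_smul, hc, ha, d_rootChain, smul_zero, sub_zero])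
      (fun i e he => by
        have h : (z (.inl (root l)) + (X a : MvPolynomial σ k) • c (root l) -
            (X a : MvPolynomial σ k) • rootChain g (root l)) i = r i := by
          rw [Pi.sub_apply, hgr, rootChain_root]
          simp
        rw [h]
        by_cases hea : e a = 0
        · have h := hroot i e (by simpa [hea] using he)
          have h' := congrArg (coeff e) (hgr i)
          simp only [Pi.add_apply, Pi.smul_apply, smul_eq_mul, coeff_add,
            X_mul_eq_zero_coeff hea, add_zero, zero_add] at h'
          rw [← h']
          exact h
        · exact hr i e hea)
    refine ⟨fun | .inl t => w t | .inr t => rootChain g t - c t, fun t => ?_⟩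
    cases t with
    | inl t =>
      simp only [d_inl]
      rw [hw, smul_sub]
      abel
    | inr t =>
      simp only [d_inr]
      rw [d_sub, hc, d_rootChain, zero_sub, neg_neg]

/-- The parity grading, in which every variable is odd. -/
abbrev IsParity (f : MvPolynomial σ k) (ε : ZMod 2) : Prop :=
  IsWeightedHomogeneous (fun _ : σ => (1 : ZMod 2)) f ε

/-- The homogeneous component for the parity grading. -/
noncomputable abbrev parityPart (ε : ZMod 2) : MvPolynomial σ k →ₗ[k] MvPolynomial σ k :=
  weightedHomogeneousComponent (fun _ : σ => (1 : ZMod 2)) ε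

lemma parityPart_X_mul (ε : ZMod 2) (a : σ) (f : MvPolynomial σ k) :
    parityPart ε (X a * f) = X a * parityPart (ε + 1) f := by
  classical
  ext e
  simp only [coeff_weightedHomogeneousComponent, coeff_X_mul']
  by_cases h : e a = 0
  · simp [h]
  · obtain ⟨e, rfl⟩ : ∃ e', e = e' + Finsupp.single a 1 :=
      ⟨e - Finsupp.single a 1, (tsub_add_cancel_of_le
        (by simpa [Nat.one_le_iff_ne_zero] using h)).symm⟩
    have h2 : ∀ u v : ZMod 2, u + 1 = v ↔ u = v + 1 := by decide
    simp [Finsupp.weight_single, h2]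

end Polynomial

end Koszul

/-! ### From even acyclicity to the parity of the syzygy degrees. -/

namespace Koszul

open MvPolynomial NumSemigroup

variable {k : Type*} [Field k]

/-- Vanishing, in even parity and away from the root, of the Koszul homology of the quotient of
the polynomial ring by `I`. -/
def EvenAcyclic {m : ℕ} (I : Ideal (MvPolynomial (Fin m) k)) : Prop :=
  ∀ w : Index (List.finRange m) → MvPolynomial (Fin m) k, (∀ t, IsParity (w t) 0) →
    (∀ t, d (fun i => (X i : MvPolynomial (Fin m) k)) w t ∈ I) →
    ∃ (u : Index (List.finRange m) → MvPolynomial (Fin m) k) (c : k), ∀ t,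
      w t - d (fun i => (X i : MvPolynomial (Fin m) k)) u t - rootChain (C c) t ∈ I

section Resolution

variable {m : ℕ} {c : Fin m → ℕ} (R : MinimalResolution k c)

local notation "V" => fun i => (X i : MvPolynomial (Fin m) k)

/-- Since all generators are odd, the weighted degree modulo 2 just counts variables, so the grading
of the resolution refines the parity grading. -/
lemma weight_cast (hodd : ∀ i, Odd (c i)) (e : Fin m →₀ ℕ) :
    ((Finsupp.weight c e : ℕ) : ZMod 2) = Finsupp.weight (fun _ : Fin m => (1 : ZMod 2)) e := by
  rw [Finsupp.weight_apply, Finsupp.weight_apply, Finsupp.sum, Finsupp.sum, Nat.cast_sum]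
  refine Finset.sum_congr rfl fun i _ => ?_
  rw [smul_eq_mul, Nat.cast_mul, (ZMod.natCast_eq_one_iff_odd).2 (hodd i), nsmul_eq_mul]

/-- The vector `v` in the `i`-th free module is homogeneous of parity `ε`. -/
def IsVecParity (i : ℕ) (ε : ZMod 2) (v : Fin (R.rank i) → MvPolynomial (Fin m) k) : Prop :=
  ∀ r, IsParity (v r) (ε + R.degree i r)

lemma isParity_diff (hodd : ∀ i, Odd (c i)) (i : ℕ) (r : Fin (R.rank i))
    (j : Fin (R.rank (i + 1))) :
    IsParity (R.diff i r j) (R.degree (i + 1) j + R.degree i r) := by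
  intro e he
  rw [← weight_cast hodd, ← R.homogeneous i r j e he, Nat.cast_add, add_assoc,
    CharTwo.add_self_eq_zero, add_zero]

lemma IsVecParity.mulVec (hodd : ∀ i, Odd (c i)) {i : ℕ} {ε : ZMod 2}
    {v : Fin (R.rank (i + 1)) → MvPolynomial (Fin m) k} (hv : IsVecParity R (i + 1) ε v) :
    IsVecParity R i ε ((R.diff i).mulVec v) := by
  intro r
  refine IsWeightedHomogeneous.sum _ _ _ fun j _ => ?_
  convert (isParity_diff R hodd i r j).mul (hv j) using 1
  linear_combination -CharTwo.add_self_eq_zero (R.degree (i + 1) j : ZMod 2)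

/-- The homogeneous component of a vector in the `i`-th free module. -/
noncomputable def vecParityPart (i : ℕ) (ε : ZMod 2) :
    (Fin (R.rank i) → MvPolynomial (Fin m) k) →+ (Fin (R.rank i) → MvPolynomial (Fin m) k) where
  toFun v r := parityPart (ε + R.degree i r) (v r)
  map_zero' := by ext; simp
  map_add' v w := by ext; simp

lemma isVecParity_vecParityPart (i : ℕ) (ε : ZMod 2)
    (v : Fin (R.rank i) → MvPolynomial (Fin m) k) : IsVecParity R i ε (vecParityPart R i ε v) :=
  fun _ => weightedHomogeneousComponent_isWeightedHomogeneous _ _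

lemma IsVecParity.vecParityPart_eq {i : ℕ} {ε : ZMod 2}
    {v : Fin (R.rank i) → MvPolynomial (Fin m) k} (hv : IsVecParity R i ε v) :
    vecParityPart R i ε v = v :=
  funext fun r => (hv r).weightedHomogeneousComponent_same

/-- Every term of the Koszul differential carries one variable up to sign, so it flips parity. -/
lemma d_vecParityPart (i : ℕ) (ε : ZMod 2) {l : List (Fin m)}
    (f : Index l → Fin (R.rank i) → MvPolynomial (Fin m) k) (t : Index l) :
    d V (fun t => vecParityPart R i ε (f t)) t = vecParityPart R i (ε + 1) (d V f t) := by
  refine d_intertwine _ _ _ (fun a _ v => _root_.funext fun r => ?_) f t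
  refine (parityPart_X_mul _ a (v r)).trans ?_
  have : ε + 1 + (R.degree i r : ZMod 2) + 1 = ε + R.degree i r := by
    linear_combination CharTwo.add_self_eq_zero (1 : ZMod 2)
  rw [this]
  rfl

/-- A cycle with coefficients in the `i`-th free module which vanishes at the root modulo the
variables is the boundary of a chain of the complementary parity. -/
lemma exists_isVecParity_d_eq (i : ℕ) (ε : ZMod 2)
    (z : Index (List.finRange m) → Fin (R.rank i) → MvPolynomial (Fin m) k)
    (hz : ∀ t, IsVecParity R i (ε + 1) (z t)) (hd : ∀ t, d V z t = 0)
    (hroot : ∀ r, constantCoeff (z (root _) r) = 0) :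
    ∃ w, (∀ t, IsVecParity R i ε (w t)) ∧ ∀ t, d V w t = z t := by
  obtain ⟨w, hw⟩ := exists_d_eq (List.nodup_finRange m) z hd fun r e he => by
    obtain rfl : e = 0 := Finsupp.ext fun a => he a (List.mem_finRange a)
    exact hroot r
  refine ⟨fun t => vecParityPart R i ε (w t), fun t => isVecParity_vecParityPart R i ε _,
    fun t => ?_⟩
  rw [d_vecParityPart, hw, (hz t).vecParityPart_eq]

lemma constantCoeff_mulVec (i : ℕ) (v : Fin (R.rank (i + 1)) → MvPolynomial (Fin m) k)
    (r : Fin (R.rank i)) : constantCoeff ((R.diff i).mulVec v r) = 0 := by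
  simp [Matrix.mulVec, dotProduct, R.minimal]

/-- The syzygy module `im (F_{i+1} → F_i)` has no Koszul homology in parity `i + 1`. -/
theorem exists_d_mulVec_eq (hodd : ∀ i, Odd (c i)) (hI : EvenAcyclic (relationIdeal k c)) (i : ℕ)
    (z : Index (List.finRange m) → Fin (R.rank (i + 1)) → MvPolynomial (Fin m) k)
    (hz : ∀ t, IsVecParity R i (i + 1) ((R.diff i).mulVec (z t)))
    (hd : ∀ t, d V (fun t => (R.diff i).mulVec (z t)) t = 0) :
    ∃ u : Index (List.finRange m) → Fin (R.rank (i + 1)) → MvPolynomial (Fin m) k,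
      ∀ t, d V (fun t => (R.diff i).mulVec (u t)) t = (R.diff i).mulVec (z t) := by
  -- Minimality gives the vanishing at the root, so the cycle bounds a chain `w` in the `i`-th free
  -- module, of parity `i`. This is the connecting map of the dimension shift.
  obtain ⟨w, hw, hdw⟩ := exists_isVecParity_d_eq R i i _ hz hd
    fun r => constantCoeff_mulVec R i _ r
  induction i with
  | zero =>
    have hdeg (r : Fin (R.rank 0)) : ((0 : ℕ) : ZMod 2) + R.degree 0 r = 0 := by
      simp [R.degree_zero]
    have : Unique (Fin (R.rank 0)) := by rw [R.rank_zero]; infer_instance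
    let r₀ : Fin (R.rank 0) := default
    have hproj {l : List (Fin m)} (f : Index l → Fin (R.rank 0) → MvPolynomial (Fin m) k)
        (t : Index l) : d V (fun t => f t r₀) t = d V f t r₀ :=
      d_map _ (LinearMap.proj r₀) f t
    -- The free module `F_0` is the polynomial ring and `w` is even, so even acyclicity applies; the
    -- corrections `d u` and the root chain are cycles and drop out under `d`.
    obtain ⟨u, a, hu⟩ := hI (fun t => w t r₀) (fun t => by simpa only [hdeg] using hw t r₀)
      fun t => by
        rw [hproj, hdw]
        exact (R.exact_zero _).2 ⟨_, rfl⟩ r₀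
    have hv : ∀ t, ∃ v, (R.diff 0).mulVec v = fun _ => w t r₀ - d V u t - rootChain (C a) t :=
      fun t => (R.exact_zero _).1 fun _ => hu t
    choose v hv using hv
    refine ⟨v, fun t => ?_⟩
    ext1 r
    obtain rfl : r = r₀ := Subsingleton.elim _ _
    rw [← hproj, ← congrFun (hdw t) r₀, ← hproj]
    simp only [hv]
    rw [d_sub, d_sub, d_rootChain, sub_zero]
    rw [sub_eq_self]
    exact d_d _ u t
  | succ i ih =>
    have hdiff {l : List (Fin m)} (f : Index l → Fin (R.rank (i + 1)) → MvPolynomial (Fin m) k)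
        (t : Index l) : d V (fun t => (R.diff i).mulVec (f t)) t = (R.diff i).mulVec (d V f t) :=
      d_map _ (R.diff i).mulVecLin f t
    have hcyc : ∀ t, d V (fun t => (R.diff i).mulVec (w t)) t = 0 := fun t => by
      rw [hdiff, hdw]
      exact (R.exact_succ i _).2 ⟨_, rfl⟩
    have hpar : ∀ t, IsVecParity R i (i + 1) ((R.diff i).mulVec (w t)) := fun t => by
      have := (hw t).mulVec R hodd
      simpa using this
    obtain ⟨w', hw', hdw'⟩ := exists_isVecParity_d_eq R i i _ hpar hcyc
      fun r => constantCoeff_mulVec R i _ r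
    -- The shift continues with the image of `w` one step down; exactness then lifts `w - d v` to
    -- the next free module.
    obtain ⟨v, hv⟩ := ih w hpar hcyc w' hw' hdw'
    have hmem : ∀ t, ∃ u, (R.diff (i + 1)).mulVec u = w t - d V v t := fun t =>
      (R.exact_succ i _).1 <| by rw [Matrix.mulVec_sub, ← hdiff, hv, sub_self]
    choose u hu using hmem
    refine ⟨u, fun t => ?_⟩
    simp only [hu]
    rw [d_sub, hdw, sub_eq_self]
    exact d_d _ v t

/-- The `i`-th syzygy degrees have the parity of `i + 1`. -/
theorem degree_succ_cast (hodd : ∀ i, Odd (c i)) (hI : EvenAcyclic (relationIdeal k c)) (i : ℕ)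
    (j : Fin (R.rank (i + 1))) : (R.degree (i + 1) j : ZMod 2) = i := by
  by_contra hne
  have hdeg : (R.degree (i + 1) j : ZMod 2) = i + 1 := by
    generalize (R.degree (i + 1) j : ZMod 2) = a at hne
    generalize (i : ZMod 2) = b at hne
    revert a b
    decide
  have hmap (v : Fin (R.rank (i + 1)) → MvPolynomial (Fin m) k) {l : List (Fin m)}
      (t : Index l) :
      (R.diff i).mulVec (rootChain v t) = rootChain ((R.diff i).mulVec v) t := by
    induction t with
    | nil => rfl
    | inl t ih => exact ih
    | inr t ih => exact Matrix.mulVec_zero _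
  have hsingle : IsVecParity R i (i + 1) ((R.diff i).mulVec (Pi.single j 1)) := by
    intro r
    rw [Matrix.mulVec_single_one, ← hdeg]
    exact isParity_diff R hodd i r j
  have hpar {l : List (Fin m)} (t : Index l) :
      IsVecParity R i (i + 1) (rootChain ((R.diff i).mulVec (Pi.single j 1)) t) := by
    induction t with
    | nil => exact hsingle
    | inl t ih => exact ih
    | inr t ih => exact fun r => isWeightedHomogeneous_zero _ _ _
  -- A root chain is a cycle. Being a boundary here means that the image of the `j`-th basis vector
  -- lies in the ideal of the variables times the syzygy module.
  obtain ⟨u, hu⟩ := exists_d_mulVec_eq R hodd hI i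
    (rootChain (Pi.single j 1)) (fun t => by rw [hmap]; exact hpar t)
    (fun t => by simp only [hmap, d_rootChain])
  have hroot := hu (root _)
  rw [rootChain_root, show d V (fun t => (R.diff i).mulVec (u t)) (root _) =
    (R.diff i).mulVec (d V u (root _)) from d_map _ (R.diff i).mulVecLin u _] at hroot
  -- Nakayama: the basis vector is a combination of variables plus an image under a minimal
  -- differential, so its constant coefficient `1` would be `0`.
  obtain ⟨w, hw⟩ := (R.exact_succ i (Pi.single j 1 - d V u (root _))).1 <| by
    rw [Matrix.mulVec_sub, hroot, sub_self]
  have h := congrArg constantCoeff (congrFun hw j)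
  rw [constantCoeff_mulVec, Pi.sub_apply, map_sub, Pi.single_eq_same, map_one,
    constantCoeff_eq, coeff_d_root u j fun _ _ => rfl, sub_zero] at h
  exact zero_ne_one h

end Resolution

end Koszul

/-! ### A criterion for even acyclicity. -/

namespace Koszul

open MvPolynomial NumSemigroup

variable {k : Type*} [Field k]

section Linear

variable {σ : Type*} (φ : σ → MvPolynomial σ k →+ k)

local notation "V" => fun i => (X i : MvPolynomial σ k)

lemma functional_d_C_eq_zero {l : List σ} {b : σ}
    (h : ∀ a ∈ l, ∀ c, φ b (X a * C c) = 0) (f : Index l → k) (t : Index l) :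
    φ b (d V (fun t => C (f t)) t) = 0 := by
  induction t with
  | nil => simp
  | inl t ih =>
    rw [d_inl, map_add, ih fun a ha => h a (List.mem_cons_of_mem _ ha), smul_eq_mul,
      h _ List.mem_cons_self, add_zero]
  | inr t ih =>
    rw [d_inr, map_neg, ih fun a ha => h a (List.mem_cons_of_mem _ ha), neg_zero]

/-- A chain of constants whose Koszul boundary vanishes is concentrated at the root. -/
lemma eq_rootChain_of_functional_d_C {l : List σ} (hl : l.Nodup)
    (hself : ∀ a ∈ l, ∀ c, φ a (X a * C c) = c)
    (hne : ∀ a ∈ l, ∀ b ∈ l, a ≠ b → ∀ c, φ b (X a * C c) = 0)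
    (f : Index l → k) (h : ∀ b ∈ l, ∀ t, φ b (d V (fun t => C (f t)) t) = 0) (t : Index l) :
    f t = rootChain (f (root l)) t := by
  induction l with
  | nil => cases t; rfl
  | cons a l ih =>
    obtain ⟨hal, hl⟩ := List.nodup_cons.1 hl
    have hne' : ∀ b ∈ l, b ≠ a := fun b hb h => hal (h ▸ hb)
    cases t with
    | inl t =>
      refine ih hl (fun b hb => hself b (List.mem_cons_of_mem _ hb))
        (fun b hb b' hb' => hne b (List.mem_cons_of_mem _ hb) b' (List.mem_cons_of_mem _ hb'))
        (fun t => f (.inl t)) (fun b hb t => ?_) t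
      have := h b (List.mem_cons_of_mem _ hb) (.inl t)
      rwa [d_inl, map_add, smul_eq_mul, hne a List.mem_cons_self b (List.mem_cons_of_mem _ hb)
        (hne' b hb).symm, add_zero] at this
    | inr t =>
      have := h a List.mem_cons_self (.inl t)
      rwa [d_inl, map_add, smul_eq_mul, hself a List.mem_cons_self, functional_d_C_eq_zero φ
        (fun b hb => hne b (List.mem_cons_of_mem _ hb) a List.mem_cons_self (hne' b hb)),
        zero_add] at this

lemma C_rootChain {l : List σ} (c : k) (t : Index l) :
    C (rootChain c t) = (rootChain (C c) t : MvPolynomial σ k) := by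
  induction t with
  | nil => rfl
  | inl t ih => exact ih
  | inr t ih => exact C_0

/-- A criterion for the Koszul homology of the quotient by the ideal `I` to vanish in even
parity: the variable `X a` is a nonzerodivisor modulo `I`, every even polynomial is congruent to a
constant modulo `X a` and `I`, and the other variables are linearly independent modulo `X a`
and `I`. -/
lemma exists_sub_d_mem {a : σ} {l : List σ} (hl : l.Nodup) (I : Ideal (MvPolynomial σ k))
    (hreg : ∀ f, X a * f ∈ I → f ∈ I)
    (heven : ∀ f, IsParity f 0 → ∃ c g, f - (C c + X a * g) ∈ I)
    (hφI : ∀ b ∈ l, ∀ f ∈ I, φ b f = 0) (hφX : ∀ b ∈ l, ∀ f, φ b (X a * f) = 0)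
    (hself : ∀ b ∈ l, ∀ c, φ b (X b * C c) = c)
    (hne : ∀ b ∈ l, ∀ b' ∈ l, b ≠ b' → ∀ c, φ b' (X b * C c) = 0)
    (w : Index (a :: l) → MvPolynomial σ k) (hw : ∀ t, IsParity (w t) 0)
    (hd : ∀ t, d V w t ∈ I) :
    ∃ (u : Index (a :: l) → MvPolynomial σ k) (c : k),
      ∀ t, w t - d V u t - rootChain (C c) t ∈ I := by
  choose c g hcg using fun t : Index l => heven _ (hw (.inl t))
  have hdcg (t : Index l) : d V (fun t => w (.inl t)) t - (d V (fun t => C (c t)) t +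
      X a * d V g t) ∈ I := by
    have := d_mem V I (fun t => w (.inl t) - (C (c t) + X a * g t)) hcg t
    rwa [d_sub, d_add, show d V (fun t => X a * g t) t = X a * d V g t from
      d_smul V (X a) g t] at this
  have hsum (t : Index l) : d V (fun t => C (c t)) t + X a * (d V g t + w (.inr t)) ∈ I := by
    have h₁ : d V (fun t => w (.inl t)) t + X a * w (.inr t) ∈ I := hd (.inl t)
    convert I.sub_mem h₁ (hdcg t) using 1
    ring
  -- Modulo `X a` and `I` the chain of constants `c` is a cycle; the functionals `φ b` detect the
  -- coefficients of its boundary, so only the root value survives.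
  have hc (t : Index l) : c t = rootChain (c (root l)) t := by
    refine eq_rootChain_of_functional_d_C φ hl hself hne c (fun b hb t => ?_) t
    have := hφI b hb _ (hsum t)
    rwa [map_add, hφX b hb, add_zero] at this
  have hcC (t : Index l) : C (c t) = (rootChain (C (c (root l))) t : MvPolynomial σ k) := by
    rw [hc t, C_rootChain]
  refine ⟨fun | .inl _ => 0 | .inr t => g t, c (root l), fun t => ?_⟩
  cases t with
  | inl t =>
    simp only [d_inl, rootChain]
    rw [d_zero, ← hcC, zero_add, smul_eq_mul]
    convert hcg t using 1
    ring
  | inr t =>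
    simp only [d_inr, rootChain]
    -- After multiplication by `X a` the claim is `hsum`, since the constants form a root chain and
    -- have zero boundary.
    refine hreg _ ?_
    have hzero : d V (fun t => (C (c t) : MvPolynomial σ k)) t = 0 := by
      rw [show (fun t => (C (c t) : MvPolynomial σ k)) = (rootChain (C (c (root l))) : Index l → MvPolynomial σ k) from
        _root_.funext hcC]
      exact d_rootChain V _ t
    have := hsum t
    rw [hzero, zero_add] at this
    convert this using 2
    ring

end Linear

/-! ### Arithmetic of the tuple and its relations. -/

section Arith

variable {n a : ℕ}

lemma arithTuple_zero : arithTuple n a 0 = 2 * n + 1 := by simp [arithTuple]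

lemma odd_arithTuple (j : Fin (2 * n + 1)) : Odd (arithTuple n a j) := by
  refine ⟨n + j * a, ?_⟩
  unfold arithTuple
  ring

lemma weight_arithTuple (e : Fin (2 * n + 1) →₀ ℕ) : Finsupp.weight (arithTuple n a) e =
    (2 * n + 1) * (∑ i, e i) + 2 * a * ∑ i : Fin (2 * n + 1), e i * i := by
  rw [Finsupp.weight_apply, Finsupp.sum_fintype _ _ (by simp), Finset.mul_sum, Finset.mul_sum,
    ← Finset.sum_add_distrib]
  refine Finset.sum_congr rfl fun i _ => ?_
  simp only [arithTuple, smul_eq_mul]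
  ring

lemma coprime_two_mul (hgcd : Nat.gcd (2 * n + 1) a = 1) : Nat.Coprime (2 * n + 1) (2 * a) :=
  Nat.Coprime.mul_right (by simp) hgcd

/-- A generator other than the multiplicity does not become an element of the semigroup when the
multiplicity is subtracted. -/
lemma weight_add_ne (hgcd : Nat.gcd (2 * n + 1) a = 1) {j : Fin (2 * n + 1)} (hj : j ≠ 0)
    (e : Fin (2 * n + 1) →₀ ℕ) :
    Finsupp.weight (arithTuple n a) e + (2 * n + 1) ≠ arithTuple n a j := by
  intro h
  rw [weight_arithTuple] at h
  set E := ∑ i, e i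
  set W := ∑ i : Fin (2 * n + 1), e i * i
  unfold arithTuple at h
  have h' : (2 * n + 1) * E + 2 * a * W = 2 * a * j := by linarith
  have hj0 : 0 < (j : ℕ) := Nat.pos_of_ne_zero fun h => hj (Fin.ext h)
  -- If `a = 0`, coprimality forces `2n + 1 = 1`, and then no index `j ≠ 0` exists.
  have ha : 0 < 2 * a := by
    rcases Nat.eq_zero_or_pos a with rfl | h
    · simp at hgcd
      subst hgcd
      have := j.2
      omega
    · omega
  have hWj : W ≤ j := by
    by_contra hlt
    have := Nat.mul_lt_mul_of_pos_left (not_le.1 hlt) ha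
    have := Nat.zero_le ((2 * n + 1) * E)
    omega
  obtain ⟨s, hs⟩ := Nat.exists_eq_add_of_le hWj
  have h2 : (2 * n + 1) * E = 2 * a * s := by
    rw [hs, mul_add] at h'
    omega
  have hdvd : 2 * n + 1 ∣ s := (coprime_two_mul hgcd).dvd_of_dvd_mul_left ⟨E, h2.symm⟩
  have hs0 : s = 0 := Nat.eq_zero_of_dvd_of_lt hdvd (by have := j.2; omega)
  subst hs0
  have hE : E = 0 := by simpa using h2
  have he : ∀ i, e i = 0 := by simpa [E] using hE
  have : W = 0 := by simp [W, he]
  omega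

lemma mem_relationIdeal {m : ℕ} {c : Fin m → ℕ} {f : MvPolynomial (Fin m) k} :
    f ∈ relationIdeal k c ↔ aeval (fun i => (Polynomial.X : Polynomial k) ^ c i) f = 0 :=
  RingHom.mem_ker

lemma aeval_monomial_eq {m : ℕ} (c : Fin m → ℕ) (e : Fin m →₀ ℕ) (b : k) :
    aeval (fun i => (Polynomial.X : Polynomial k) ^ c i) (monomial e b) =
      Polynomial.monomial (Finsupp.weight c e) b := by
  rw [aeval_monomial, Finsupp.weight_apply, ← Polynomial.C_mul_X_pow_eq_monomial,
    Polynomial.algebraMap_eq, Finsupp.sum, Finsupp.prod, ← Finset.prod_pow_eq_pow_sum]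
  congr 1
  refine Finset.prod_congr rfl fun i _ => ?_
  rw [← pow_mul, smul_eq_mul, mul_comm]

lemma X_mul_mem_relationIdeal {m : ℕ} {c : Fin m → ℕ} {i : Fin m} {f : MvPolynomial (Fin m) k}
    (h : X i * f ∈ relationIdeal k c) : f ∈ relationIdeal k c := by
  rw [mem_relationIdeal] at h ⊢
  rw [map_mul, aeval_X] at h
  exact (mul_eq_zero.1 h).resolve_left (pow_ne_zero _ Polynomial.X_ne_zero)

/-- The sum of two generators is the multiplicity plus an element of the semigroup. -/
lemma exists_X_mul_X_sub_mem (i j : Fin (2 * n + 1)) :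
    ∃ p : MvPolynomial (Fin (2 * n + 1)) k,
      X i * X j - X 0 * p ∈ relationIdeal k (arithTuple n a) := by
  by_cases h : (i : ℕ) + j < 2 * n + 1
  · refine ⟨X ⟨i + j, h⟩, ?_⟩
    rw [mem_relationIdeal]
    simp only [map_sub, map_mul, aeval_X, ← pow_add, arithTuple]
    rw [sub_eq_zero]
    congr 1
    simp
    ring
  -- With `i + j = 2n + 1 + s`, the excess `2a(2n + 1)` is `2a` copies of the multiplicity, whence
  -- the factor `X 0 ^ (2 * a)`.
  · refine ⟨X 0 ^ (2 * a) * X ⟨i + j - (2 * n + 1), by omega⟩, ?_⟩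
    rw [mem_relationIdeal]
    simp only [map_sub, map_mul, map_pow, aeval_X, ← pow_add, ← pow_mul, arithTuple]
    rw [sub_eq_zero]
    congr 1
    obtain ⟨s, hs⟩ := Nat.exists_eq_add_of_le (not_lt.1 h)
    have : (i : ℕ) + j - (2 * n + 1) = s := by omega
    simp only [this]
    have h3 : 2 * (i : ℕ) * a + 2 * j * a = 2 * (i + j) * a := by ring
    have h4 : 2 * n + 1 + 2 * (i : ℕ) * a + (2 * n + 1 + 2 * j * a) =
      2 * (2 * n + 1) + 2 * (i + j) * a := by rw [← h3]; ring
    rw [h4, hs]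
    simp
    ring

lemma exists_eq_add_single {σ : Type*} {e : σ →₀ ℕ} {i : σ} (h : e i ≠ 0) :
    ∃ e', e = e' + Finsupp.single i 1 :=
  ⟨e - Finsupp.single i 1, (tsub_add_cancel_of_le
    (by simpa [Nat.one_le_iff_ne_zero] using h)).symm⟩

/-- A nonconstant monomial of even parity contains at least two variables, and their product can be
traded for a multiple of `X 0`. -/
lemma exists_monomial_sub_mem (e : Fin (2 * n + 1) →₀ ℕ) (b : k)
    (he : Finsupp.weight (fun _ => (1 : ZMod 2)) e = 0) :
    ∃ (c : k) (g : MvPolynomial (Fin (2 * n + 1)) k),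
      monomial e b - (C c + X 0 * g) ∈ relationIdeal k (arithTuple n a) := by
  by_cases h : e = 0
  · exact ⟨b, 0, by simp [h, ← C_apply]⟩
  obtain ⟨i, hi⟩ := Finsupp.ne_iff.1 h
  obtain ⟨e, rfl⟩ := exists_eq_add_single hi
  have h' : e ≠ 0 := by
    rintro rfl
    simp [Finsupp.weight_single] at he
  obtain ⟨j, hj⟩ := Finsupp.ne_iff.1 h'
  obtain ⟨e, rfl⟩ := exists_eq_add_single hj
  obtain ⟨p, hp⟩ := exists_X_mul_X_sub_mem (k := k) (a := a) j i
  refine ⟨0, p * monomial e b, ?_⟩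
  convert Ideal.mul_mem_right (monomial e b) _ hp using 1
  rw [monomial_add_single, monomial_add_single, C_0]
  ring

lemma exists_even_sub_mem (f : MvPolynomial (Fin (2 * n + 1)) k) (hf : IsParity f 0) :
    ∃ (c : k) (g : MvPolynomial (Fin (2 * n + 1)) k),
      f - (C c + X 0 * g) ∈ relationIdeal k (arithTuple n a) := by
  choose! c g h using fun (e : Fin (2 * n + 1) →₀ ℕ) =>
    exists_monomial_sub_mem (k := k) (a := a) e (coeff e f)
  refine ⟨∑ e ∈ f.support, c e, ∑ e ∈ f.support, g e, ?_⟩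
  have := Ideal.sum_mem (relationIdeal k (arithTuple n a)) fun e (he : e ∈ f.support) =>
    h e (hf (mem_support_iff.1 he))
  rwa [Finset.sum_sub_distrib, Finset.sum_add_distrib, ← Finset.mul_sum, ← map_sum,
    ← f.as_sum] at this

end Arith

end Koszul

/-! ### Even acyclicity of the semigroup ring. -/

namespace Koszul

open MvPolynomial NumSemigroup

variable {k : Type*} [Field k] {n a : ℕ}

/-- The coefficient of `z ^ N` in the semigroup ring. -/
noncomputable def semigroupCoeff {m : ℕ} (c : Fin m → ℕ) (N : ℕ) : MvPolynomial (Fin m) k →+ k :=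
  ((Polynomial.lcoeff k N).comp
    (aeval fun i => (Polynomial.X : Polynomial k) ^ c i).toLinearMap).toAddMonoidHom

lemma semigroupCoeff_apply {m : ℕ} (c : Fin m → ℕ) (N : ℕ) (f : MvPolynomial (Fin m) k) :
    semigroupCoeff c N f = (aeval (fun i => (Polynomial.X : Polynomial k) ^ c i) f).coeff N := rfl

lemma semigroupCoeff_X_mul_eq_zero {m : ℕ} {c : Fin m → ℕ} {N : ℕ} {i : Fin m}
    (h : ∀ e : Fin m →₀ ℕ, Finsupp.weight c e + c i ≠ N) (f : MvPolynomial (Fin m) k) :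
    semigroupCoeff c N (X i * f) = 0 := by
  induction f using MvPolynomial.induction_on' with
  | monomial e b =>
    rw [semigroupCoeff_apply, map_mul, aeval_X, aeval_monomial_eq, mul_comm,
      ← Polynomial.C_mul_X_pow_eq_monomial, mul_assoc, ← pow_add, Polynomial.coeff_C_mul_X_pow,
      if_neg (h e).symm]
  | add p q hp hq => rw [mul_add, map_add, hp, hq, add_zero]

lemma semigroupCoeff_X_mul_C {m : ℕ} (c : Fin m → ℕ) (N : ℕ) (i : Fin m) (b : k) :
    semigroupCoeff c N (X i * C b) = if N = c i then b else 0 := by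
  rw [semigroupCoeff_apply, map_mul, aeval_X, algHom_C, Polynomial.algebraMap_eq, mul_comm,
    Polynomial.coeff_C_mul_X_pow]

/-- The functional dual to `X b` is the coefficient of `z ^ c_b`. It factors through the semigroup
ring, and it kills multiples of `X 0` because `c_b - c_0` is not in the semigroup. -/
theorem evenAcyclic_relationIdeal (ha : 1 ≤ a) (hgcd : Nat.gcd (2 * n + 1) a = 1) :
    EvenAcyclic (relationIdeal k (arithTuple n a)) := by
  have hinj : Function.Injective (arithTuple n a) := fun i j h => by
    unfold arithTuple at h
    have h' : 2 * (i : ℕ) * a = 2 * j * a := by omega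
    have := Nat.eq_of_mul_eq_mul_right ha h'
    exact Fin.ext (by omega)
  unfold EvenAcyclic
  have hnodup := List.nodup_finRange (2 * n + 1)
  rw [List.finRange_succ] at hnodup ⊢
  obtain ⟨h0, hl⟩ := List.nodup_cons.1 hnodup
  refine exists_sub_d_mem (fun j => semigroupCoeff (arithTuple n a) (arithTuple n a j)) hl _
    (fun f => X_mul_mem_relationIdeal) exists_even_sub_mem ?_ ?_ ?_ ?_
  · intro b _ f hf
    rw [semigroupCoeff_apply, mem_relationIdeal.1 hf, Polynomial.coeff_zero]
  · intro b hb f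
    refine semigroupCoeff_X_mul_eq_zero (fun e => ?_) f
    rw [arithTuple_zero]
    exact weight_add_ne hgcd (fun h => h0 (h ▸ hb)) e
  · intro b _ c
    rw [semigroupCoeff_X_mul_C, if_pos rfl]
  · intro b _ b' _ hbb c
    rw [semigroupCoeff_X_mul_C, if_neg (hinj.ne hbb.symm)]

/-! ### Conductor, gaps and the vanishing of `ℓ`. -/

lemma mem_semigroup (j : Fin (2 * n + 1)) (s : ℕ) :
    arithTuple n a j + s * (2 * n + 1) ∈ semigroup (arithTuple n a) := by
  refine add_mem (AddSubmonoid.subset_closure ⟨j, rfl⟩) ?_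
  have h : 2 * n + 1 ∈ semigroup (arithTuple n a) :=
    AddSubmonoid.subset_closure ⟨0, arithTuple_zero⟩
  exact nsmul_mem h s

/-- Every natural number is congruent to some `2ja`, `j ≤ 2n`, modulo `2n+1`. -/
lemma exists_modEq (hgcd : Nat.gcd (2 * n + 1) a = 1) (h : ℕ) :
    ∃ j : Fin (2 * n + 1), h ≡ 2 * j * a [MOD 2 * n + 1] := by
  obtain ⟨j, hj, hjh⟩ := Nat.exists_mul_mod_eq_of_coprime h (coprime_two_mul hgcd).symm
    (Nat.succ_ne_zero _)
  refine ⟨⟨j, hj⟩, ?_⟩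
  rw [mul_right_comm]
  exact hjh.symm

lemma mem_semigroup_of_lt {h : ℕ} {j : Fin (2 * n + 1)}
    (hj : h ≡ 2 * j * a [MOD 2 * n + 1]) (hlt : 2 * j * a < h) :
    h ∈ semigroup (arithTuple n a) := by
  obtain ⟨s, hs⟩ := (Nat.modEq_iff_dvd' hlt.le).1 hj.symm
  have hs0 : s ≠ 0 := by
    rintro rfl
    omega
  obtain ⟨s, rfl⟩ := Nat.exists_eq_succ_of_ne_zero hs0
  have : h = arithTuple n a j + s * (2 * n + 1) := by
    have h1 : h = 2 * j * a + (2 * n + 1) * (s + 1) := (Nat.sub_eq_iff_eq_add' hlt.le).1 hs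
    rw [h1, arithTuple]
    ring
  rw [this]
  exact mem_semigroup j s

lemma exists_weight_of_mem {m : ℕ} {c : Fin m → ℕ} {s : ℕ} (hs : s ∈ semigroup c) :
    ∃ e : Fin m →₀ ℕ, Finsupp.weight c e = s := by
  induction hs using AddSubmonoid.closure_induction with
  | mem x hx =>
    obtain ⟨i, rfl⟩ := hx
    exact ⟨Finsupp.single i 1, by simp [Finsupp.weight_single]⟩
  | zero => exact ⟨0, map_zero _⟩
  | add x y _ _ hx hy =>
    obtain ⟨e, rfl⟩ := hx
    obtain ⟨e', rfl⟩ := hy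
    exact ⟨e + e', map_add _ _ _⟩

/-- In the class of `2ja` everything above `2ja` is in the semigroup, and `j = 2n` gives the largest
bound. The number `4na` is itself a gap, being the last generator minus the multiplicity. -/
lemma conductor_arithTuple (hn : 1 ≤ n) (hgcd : Nat.gcd (2 * n + 1) a = 1) :
    conductor (arithTuple n a) = 4 * n * a + 1 := by
  have hmem (h : ℕ) (hh : 4 * n * a < h) : h ∈ semigroup (arithTuple n a) := by
    obtain ⟨j, hj⟩ := exists_modEq hgcd h
    refine mem_semigroup_of_lt hj (lt_of_le_of_lt ?_ hh)
    exact Nat.mul_le_mul_right _ (by have := j.2; omega)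
  have hF : 4 * n * a ∉ semigroup (arithTuple n a) := by
    intro h
    obtain ⟨e, he⟩ := exists_weight_of_mem h
    refine weight_add_ne hgcd (j := Fin.last (2 * n)) ?_ e ?_
    · simp [Fin.ext_iff]
      omega
    · rw [he, arithTuple, Fin.val_last]
      ring
  refine (IsLeast.csInf_eq ⟨⟨hmem _ (Nat.lt_succ_self _), fun t => hmem _ (by omega)⟩, ?_⟩)
  rintro s ⟨_, hs⟩
  by_contra hlt
  have := hs (4 * n * a - s)
  rw [Nat.add_sub_cancel' (by omega)] at this
  exact hF this

lemma frobenius_arithTuple (hn : 1 ≤ n) (hgcd : Nat.gcd (2 * n + 1) a = 1) :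
    NumSemigroup.frobenius (arithTuple n a) = 4 * n * a := by
  simp [NumSemigroup.frobenius, conductor_arithTuple hn hgcd]

lemma even_of_mem_gapsH (hn : 1 ≤ n) (hgcd : Nat.gcd (2 * n + 1) a = 1) {h : ℕ}
    (hh : h ∈ gapsH (arithTuple n a)) : Even h := by
  classical
  simp only [gapsH, Finset.mem_filter] at hh
  obtain ⟨-, hS, hF⟩ := hh
  obtain ⟨j, hj⟩ := exists_modEq hgcd h
  have hle : h ≤ 2 * j * a := not_lt.1 fun hlt => hS (mem_semigroup_of_lt hj hlt)
  obtain ⟨s, hs⟩ := (Nat.modEq_iff_dvd' hle).1 hj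
  rcases Nat.eq_zero_or_pos s with rfl | hs0
  · exact ⟨j * a, by linarith [(Nat.sub_eq_iff_eq_add' hle).1 hs]⟩
  · exfalso
    -- Here `h = 2ja - (2n+1)(s+1)`, so `F - h = 2(2n-j)a + (2n+1)(s+1)`, which is the generator of
    -- index `2n - j` plus `s` copies of the multiplicity.
    obtain ⟨s, rfl⟩ := Nat.exists_eq_succ_of_ne_zero hs0.ne'
    have hj2 := j.2
    refine hF _ (mem_semigroup (n := n) (a := a) ⟨2 * n - j, by omega⟩ s) ?_
    have h1 : (h : ℤ) = 2 * j * a - (2 * n + 1) * (s + 1) := by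
      have : 2 * (j : ℕ) * a = h + (2 * n + 1) * (s + 1) := by
        have : (2 * n + 1) * s.succ = (2 * n + 1) * (s + 1) := rfl
        omega
      zify at this
      linarith
    rw [frobenius_arithTuple hn hgcd, h1, arithTuple]
    push_cast [Nat.cast_sub (show (j : ℕ) ≤ 2 * n by omega)]
    ring

lemma cast_of_mem_shiftedSums (hn : 1 ≤ n) (hgcd : Nat.gcd (2 * n + 1) a = 1) {i x : ℕ}
    (hx : x ∈ shiftedSums (arithTuple n a) i) : (x : ZMod 2) = i := by
  simp only [shiftedSums, subsetSums, Multiset.mem_bind, Multiset.mem_map, Finset.mem_val,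
    Finset.mem_powersetCard] at hx
  obtain ⟨_, ⟨T, ⟨-, hT⟩, rfl⟩, h, hh, rfl⟩ := hx
  rw [Nat.cast_add, (ZMod.natCast_eq_zero_iff_even).2 (even_of_mem_gapsH hn hgcd hh), add_zero,
    Nat.cast_sum, Finset.sum_congr rfl fun j _ =>
      (ZMod.natCast_eq_one_iff_odd).2 (odd_arithTuple (n := n) (a := a) j)]
  simp [hT]

theorem ell_arithTuple (hn : 1 ≤ n) (hgcd : Nat.gcd (2 * n + 1) a = 1) :
    ell (arithTuple n a) = 0 := by
  rw [ell, Multiset.card_eq_zero, Multiset.eq_zero_iff_forall_notMem]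
  intro x hx
  obtain ⟨he, ho⟩ := Multiset.mem_inter.1 hx
  simp only [shiftedSumsEven, shiftedSumsOdd, Multiset.mem_sum, Finset.mem_filter] at he ho
  obtain ⟨i, ⟨-, hi⟩, hxi⟩ := he
  obtain ⟨j, ⟨-, hj⟩, hxj⟩ := ho
  have h1 := (cast_of_mem_shiftedSums hn hgcd hxi).symm.trans (cast_of_mem_shiftedSums hn hgcd hxj)
  rw [(ZMod.natCast_eq_zero_iff_even).2 hi, (ZMod.natCast_eq_one_iff_odd).2 hj] at h1
  exact zero_ne_one h1

/-! ### Parities of the conjugate degrees and the vanishing of `ρ`. -/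

lemma genSum_cast : (genSum (arithTuple n a) : ZMod 2) = 1 := by
  rw [genSum, Nat.cast_sum, Finset.sum_congr rfl fun j _ =>
    (ZMod.natCast_eq_one_iff_odd).2 (odd_arithTuple (n := n) (a := a) j)]
  simp [CharTwo.two_eq_zero]

variable (R : MinimalResolution k (arithTuple n a))

lemma cast_of_mem_syz (ha : 1 ≤ a) (hgcd : Nat.gcd (2 * n + 1) a = 1) {i : ℕ} (hi : 1 ≤ i)
    {x : ℤ} (hx : x ∈ R.syz i) : (x : ZMod 2) = i + 1 := by
  -- The case `i = 0` must be excluded: the generator of `F_0` has degree `0`, which has the wrong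
  -- parity.
  obtain ⟨i, rfl⟩ := Nat.exists_eq_add_of_le' hi
  obtain ⟨j, -, rfl⟩ := Multiset.mem_map.1 hx
  rw [Int.cast_natCast, degree_succ_cast R odd_arithTuple (evenAcyclic_relationIdeal ha hgcd)]
  push_cast
  linear_combination -CharTwo.add_self_eq_zero (1 : ZMod 2)

lemma cast_of_mem_conjSyz (hn : 1 ≤ n) (ha : 1 ≤ a) (hgcd : Nat.gcd (2 * n + 1) a = 1) {i : ℕ}
    (hi : 1 ≤ i) {x : ℤ} (hx : x ∈ R.conjSyz i) : (x : ZMod 2) = i := by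
  obtain ⟨y, hy, rfl⟩ := Multiset.mem_map.1 hx
  rw [frobenius_arithTuple hn hgcd, Int.cast_sub, cast_of_mem_syz R ha hgcd hi hy, Int.cast_add,
    Int.cast_natCast, genSum_cast]
  push_cast
  linear_combination (2 * (n : ZMod 2) * a - i) * CharTwo.two_eq_zero (R := ZMod 2)

theorem rho_arithTuple (hn : 1 ≤ n) (ha : 1 ≤ a) (hgcd : Nat.gcd (2 * n + 1) a = 1) :
    R.rho = 0 := by
  have hm : ¬Even (2 * n + 1) := by simp
  rw [MinimalResolution.rho, Multiset.card_eq_zero, Multiset.eq_zero_iff_forall_notMem]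
  intro x hx
  obtain ⟨hl, hr⟩ := Multiset.mem_inter.1 hx
  have hl0 : (x : ZMod 2) = 0 := by
    rw [MinimalResolution.leftDegrees, if_neg hm, Multiset.mem_add] at hl
    simp only [MinimalResolution.syzOdd, MinimalResolution.conjSyzEven, Multiset.mem_sum,
      Finset.mem_filter, Finset.mem_Icc] at hl
    rcases hl with ⟨i, ⟨hi, hp⟩, hxi⟩ | ⟨i, ⟨hi, hp⟩, hxi⟩
    · rw [cast_of_mem_syz R ha hgcd hi.1 hxi, (ZMod.natCast_eq_one_iff_odd).2 hp]
      exact CharTwo.add_self_eq_zero 1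
    · rw [cast_of_mem_conjSyz R hn ha hgcd hi.1 hxi, (ZMod.natCast_eq_zero_iff_even).2 hp]
  have hr1 : (x : ZMod 2) = 1 := by
    rw [MinimalResolution.rightDegrees, if_neg hm, Multiset.mem_add] at hr
    simp only [MinimalResolution.syzEven, MinimalResolution.conjSyzOdd, Multiset.mem_sum,
      Finset.mem_filter, Finset.mem_Icc] at hr
    rcases hr with ⟨i, ⟨hi, hp⟩, hxi⟩ | ⟨i, ⟨hi, hp⟩, hxi⟩
    · rw [cast_of_mem_syz R ha hgcd hi.1 hxi, (ZMod.natCast_eq_zero_iff_even).2 hp, zero_add]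
    · rw [cast_of_mem_conjSyz R hn ha hgcd hi.1 hxi, (ZMod.natCast_eq_one_iff_odd).2 hp]
  exact zero_ne_one (hl0.symm.trans hr1)

end Koszul

theorem corollary4 {k : Type*} [Field k] [CharZero k] (n a : ℕ) (hn : 1 ≤ n) (ha : 1 ≤ a)
    (hgcd : Nat.gcd (2 * n + 1) a = 1) :
    (∀ R : NumSemigroup.MinimalResolution k (NumSemigroup.arithTuple n a), R.rho = 0) ∧
      NumSemigroup.ell (NumSemigroup.arithTuple n a) = 0 :=
  ⟨fun R => Koszul.rho_arithTuple R hn ha hgcd, Koszul.ell_arithTuple hn hgcd⟩
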